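/- Let $\mathcal F$ be a real or complex Hilbert space (scalar product linear in the second argument), and let $S=(0,\infty)$ or $S=[0,\infty)$; the assertions below hold for either choice of $S$. A function $\varphi:\mathbb R\to B(\mathcal F)$ is called reflection positive for $(\mathbb R,S,-\mathrm{id})$ if (i) $\varphi$ is positive definite, i.e. the kernel $((x,v),(y,w))\mapsto\langle v,\varphi(x-y)w\rangle$ on $\mathbb R\times\mathcal F$ is positive definite (all matrices obtained from finitely many points are hermitian and positive semidefinite); (ii) $\varphi(-x)=\varphi(x)$ for all $x\in\mathbb R$; (iii) the kernel $((s,v),(t,w))\mapsto\langle v,\varphi(s+t)w\rangle$ on $S\times\mathcal F$ is positive definite. For a function $\varphi:\mathbb R\to\mathbb C$, reflection positivity is defined in the same way with the scalar kernels $\varphi(x-y)$ on $\mathbb R$ and $\varphi(s+t)$ on $S$. Write $\mathrm{Herm}(\mathcal F)_+$ for the set of bounded positive (hermitian) operators on $\mathcal F$. A finite $\mathrm{Herm}(\mathcal F)_+$-valued Borel measure on $[0,\infty)$ is a map $Q$ from the Borel sets of $[0,\infty)$ to $\mathrm{Herm}(\mathcal F)_+$ that is countably additive in the weak operator topology, and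 $A=\int f\,dQ$ means that $\langle v,Aw\rangle=\int f\,d\langle v,Q(\cdot)w\rangle$ for all $v,w\in\mathcal F$. (a) Let $\varphi:\mathbb R\to B(\mathcal F)$ be strongly continuous. Then $\varphi$ is reflection positive for $(\mathbb R,S,-\mathrm{id})$ if and only if there is a finite $\mathrm{Herm}(\mathcal F)_+$-valued Borel measure $Q$ on $[0,\infty)$ such that $$\varphi(x)=\int_0^\infty e^{-\lambda|x|}\,dQ(\lambda)\qquad\text{for all }x\in\mathbb R.$$ (b) Let $\varphi:\mathbb R\to\mathbb C$ be continuous. Then $\varphi$ is reflection positive for $(\mathbb R,S,-\mathrm{id})$ if and only if there is a finite positive Borel measure $\nu$ on $[0,\infty)$ such that $$\varphi(x)=\int_0^\infty e^{-\lambda|x|}\,d\nu(\lambda)\qquad\text{for all }x\in\mathbb R.$$ -/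

import Mathlib

open MeasureTheory
open scoped ComplexOrder NNReal

/-- A `B(F)`-valued kernel `K` on a set `X` is positive definite if the scalar kernel
`((x, v), (y, w)) ↦ ⟪v, K(x, y) w⟫` on `X × F` is positive definite, i.e. all the matrices that it
defines on finite families of points are positive semidefinite. -/
def IsPosDefOperatorKernel {X 𝕜 F : Type*} [RCLike 𝕜] [NormedAddCommGroup F]
    [InnerProductSpace 𝕜 F] (K : X → X → F →L[𝕜] F) : Prop :=
  (Matrix.of fun p q : X × F => inner 𝕜 p.2 (K p.1 q.1 q.2)).PosSemidef

/-- Let `G` be a group (written additively) with an involution `τ`, put `t♯ = -τ(t)`, and let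
`S` be a subset of `G`. A function `φ : G → B(F)` is reflection positive for `(G, S, τ)` if it is
positive definite, `τ`-invariant, and the kernel `φ(s + t♯)` is positive definite on `S`. -/
structure IsReflectionPositive {G 𝕜 F : Type*} [AddGroup G] [RCLike 𝕜] [NormedAddCommGroup F]
    [InnerProductSpace 𝕜 F] (S : Set G) (τ : G → G) (φ : G → F →L[𝕜] F) : Prop where
  posDef : IsPosDefOperatorKernel fun g h : G => φ (g - h)
  invariant : ∀ g, φ (τ g) = φ g
  posDef_on : IsPosDefOperatorKernel fun s t : S => φ (s + -τ t)

/-- Reflection positivity of a complex-valued function. -/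
structure IsReflectionPositiveScalar {G : Type*} [AddGroup G] (S : Set G) (τ : G → G)
    (φ : G → ℂ) : Prop where
  posDef : (Matrix.of fun g h : G => φ (g - h)).PosSemidef
  invariant : ∀ g, φ (τ g) = φ g
  posDef_on : (Matrix.of fun s t : S => φ (s + -τ t)).PosSemidef

section OperatorMeasure

variable {X 𝕜 F : Type*} [MeasurableSpace X] [RCLike 𝕜] [NormedAddCommGroup F]
  [InnerProductSpace 𝕜 F] [CompleteSpace F]

/-- A finite measure with values in the positive operators on `F`. Countable additivity is with
respect to the weak operator topology; all values, in particular the total mass, are bounded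
operators. -/
def IsPositiveOperatorMeasure (Q : VectorMeasure X (F →WOT[𝕜] F)) : Prop :=
  ∀ E : Set X, (Q E).toCLM.IsPositive

/-- The scalar measure `E ↦ ⟪v, Q(E) w⟫`. -/
noncomputable def matrixCoeff (Q : VectorMeasure X (F →WOT[𝕜] F)) (v w : F) :
    VectorMeasure X 𝕜 :=
  Q.mapRange
    { toFun := fun A => inner 𝕜 v (A w)
      map_zero' := by simp
      map_add' := by intro A B; simp [inner_add_right] }
    (ContinuousLinearMapWOT.continuous_inner_apply continuous_id w v)

/-- The bounded operator `A` is the (weak) integral `∫ f dQ`: for all `v`, `w` in `F`, the function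
`f` is integrable for the scalar measure `⟪v, Q(·) w⟫` and `⟪v, A w⟫ = ∫ f d⟪v, Q(·) w⟫`. -/
def HasOperatorIntegral (Q : VectorMeasure X (F →WOT[𝕜] F)) (f : X → ℝ) (A : F →L[𝕜] F) : Prop :=
  ∀ v w : F, (matrixCoeff Q v w).Integrable f ∧
    inner 𝕜 v (A w) = (matrixCoeff Q v w).integral f (ContinuousLinearMap.lsmul ℝ ℝ)

end OperatorMeasure

/-! ### The Hausdorff moment problem on the unit interval. -/

section HausdorffMoments

open Polynomial Filter Topology

/-! Scalar core (`exists_laplace_of_posDef`): positive definiteness on the group gives `|f| ≤ f 0`,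
and continuity extends positive definiteness from `S` to `[0, ∞)`. Sample `f` at the multiples of a
step `h` and let `L` be the functional on polynomials with `L (X ^ k) = f (k h)`. Positive
definiteness makes `L` nonnegative on `X ^ n * q ^ 2`, and boundedness upgrades this to `X ^ i * (1
- X) ^ j`, so the samples are the moments of a measure on `[0, 1]`. Taking `h = 2⁻ⁿ`, pushing
forward by `x ↦ x ^ 2 ^ n` and passing to a weak limit gives `f t = ∫ x ^ t` at dyadic `t`.
Continuity excludes an atom at `0` and extends the formula to all `t ≥ 0`; the substitution `x =
e^{-l}` makes it a Laplace transform.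

Operator case: the core applied to `⟪v, φ t v⟫` gives a measure `ν v` for each vector. Since Laplace
transforms determine measures, every linear relation that holds between the quadratic forms for all
`t ≥ 0` also holds between the measures (`IsLaplaceFamily.measureComb_eq`). Hence polarizing `v ↦ ν
v E` yields a bounded hermitian form, which is represented by a positive operator `Q E`.

Converse: for each fixed `l` the kernels `e^{-l|x-y|}` and `e^{-l(s+t)}` are positive semidefinite.
Integrals against `Q` are limits of Riemann sums of Schur products of positive semidefinite kernels.
-/

/-- The linear functional on polynomials with moments `m`. -/
noncomputable def momentFunctional (m : ℕ → ℝ) : ℝ[X] →ₗ[ℝ] ℝ :=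
  Polynomial.lsum fun k => LinearMap.mulRight ℝ (m k)

theorem momentFunctional_monomial (m : ℕ → ℝ) (k : ℕ) (a : ℝ) :
    momentFunctional m (monomial k a) = a * m k := by
  simp [momentFunctional, Polynomial.lsum_apply, Polynomial.sum_monomial_index]

theorem momentFunctional_X_pow (m : ℕ → ℝ) (k : ℕ) : momentFunctional m (X ^ k) = m k := by
  rw [X_pow_eq_monomial, momentFunctional_monomial, one_mul]

/-- These are the factorial moments of the binomial distribution: `C(N,i) C(i,k) = C(N,k)
C(N-k,i-k)` pulls out `X ^ k`, and the remaining Bernstein polynomials of degree `N - k` sum to `1`.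
-/
theorem sum_choose_smul_bernsteinPolynomial {N k : ℕ} (hk : k ≤ N) :
    ∑ i ∈ Finset.range (N + 1), (i.choose k : ℝ) • bernsteinPolynomial ℝ N i
      = (N.choose k : ℝ) • X ^ k := by
  obtain ⟨M, rfl⟩ := Nat.exists_eq_add_of_le hk
  rw [show k + M + 1 = k + (M + 1) by ring, Finset.sum_range_add,
    Finset.sum_eq_zero fun i hi => by
      simp [Nat.choose_eq_zero_of_lt (Finset.mem_range.1 hi)], zero_add]
  have h (j : ℕ) (hj : j ∈ Finset.range (M + 1)) :
      ((k + j).choose k : ℝ) • bernsteinPolynomial ℝ (k + M) (k + j)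
        = (((k + M).choose k : ℝ) • X ^ k) * bernsteinPolynomial ℝ M j := by
    have hj' : j ≤ M := Nat.lt_succ_iff.1 (Finset.mem_range.1 hj)
    have := Nat.choose_mul (n := k + M) (k := k + j) (s := k) (Nat.le_add_right k j)
    rw [Nat.add_sub_cancel_left, Nat.add_sub_cancel_left] at this
    have h2 : ((k + M).choose (k + j) : ℝ[X]) * ((k + j).choose k : ℝ[X])
      = ((k + M).choose k : ℝ[X]) * (M.choose j : ℝ[X]) := by exact_mod_cast this
    simp only [bernsteinPolynomial, smul_eq_C_mul, map_natCast, Nat.add_sub_add_left, pow_add]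
    linear_combination (X ^ k * X ^ j * (1 - X) ^ (M - j)) * h2
  rw [Finset.sum_congr rfl h, ← Finset.mul_sum, bernsteinPolynomial.sum, mul_one]

/-- Falling factorials have exact Bernstein sums, powers do not; the exchange costs `O(1/N)`
uniformly in `i`, because the factors `(i - j)/N` and `i/N` lie in `[0, 1]` and differ by at most
`j/N`. -/
theorem pow_div_sub_descFactorial_div_nonneg_and_le {i N : ℕ} (hN : 0 < N) (hi : i ≤ N) (k : ℕ) :
    0 ≤ (i.descFactorial k : ℝ) / N ^ k ∧
    (i.descFactorial k : ℝ) / N ^ k ≤ ((i : ℝ) / N) ^ k ∧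
    ((i : ℝ) / N) ^ k - (i.descFactorial k : ℝ) / N ^ k ≤ (k : ℝ) ^ 2 / N := by
  have hN' : (0 : ℝ) < N := by exact_mod_cast hN
  have ha1 : (i : ℝ) / N ≤ 1 := by rw [div_le_one hN']; exact_mod_cast hi
  have ha0 : 0 ≤ (i : ℝ) / N := by positivity
  refine ⟨by positivity, ?_, ?_⟩
  · rw [div_pow]
    gcongr
    exact_mod_cast Nat.descFactorial_le_pow i k
  induction k with
  | zero => simp
  | succ k ih =>
    have hv : (i.descFactorial k : ℝ) / N ^ k ≤ ((i : ℝ) / N) ^ k := by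
      rw [div_pow]
      gcongr
      exact_mod_cast Nat.descFactorial_le_pow i k
    have hu1 : ((i : ℝ) / N) ^ k ≤ 1 := pow_le_one₀ ha0 ha1
    set u := ((i : ℝ) / N) ^ k
    set v := (i.descFactorial k : ℝ) / N ^ k
    have hv0 : 0 ≤ v := by positivity
    have e : (i.descFactorial (k + 1) : ℝ) / N ^ (k + 1) = ((i - k : ℕ) : ℝ) / N * v := by
      rw [Nat.descFactorial_succ]; push_cast; simp only [v]; rw [pow_succ]; field_simp
    have hb : (i : ℝ) / N - ((i - k : ℕ) : ℝ) / N ≤ k / N := by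
      rw [← sub_div]
      gcongr
      have : i ≤ (i - k) + k := by omega
      have : (i : ℝ) ≤ ((i - k : ℕ) : ℝ) + k := by exact_mod_cast this
      linarith
    rw [pow_succ, e]
    have h1 : (i : ℝ) / N * (u - v) ≤ u - v := by nlinarith
    have h2 : ((i : ℝ) / N - ((i - k : ℕ) : ℝ) / N) * v ≤ k / N := by
      have : (k : ℝ) / N * v ≤ k / N := by
        have : (0:ℝ) ≤ k / N := by positivity
        nlinarith
      nlinarith
    have h3 : ((k : ℝ) ^ 2) / N + k / N ≤ ((k + 1 : ℕ) : ℝ) ^ 2 / N := by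
      rw [← add_div]; gcongr; push_cast; nlinarith [(Nat.cast_nonneg k : (0:ℝ) ≤ k)]
    calc u * ((i : ℝ) / N) - ((i - k : ℕ) : ℝ) / N * v
        = (i : ℝ) / N * (u - v) + ((i : ℝ) / N - ((i - k : ℕ) : ℝ) / N) * v := by ring
      _ ≤ _ := by linarith

/-- Along a nontrivial ultrafilter, every sequence of probability measures on a compact metrizable
space has a limit. -/
theorem exists_probabilityMeasure_tendsto {X ι : Type*} [TopologicalSpace X] [CompactSpace X]
    [TopologicalSpace.MetrizableSpace X] [MeasurableSpace X] [BorelSpace X]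
    (U : Ultrafilter ι) (μ : ι → ProbabilityMeasure X) :
    ∃ μ₀ : ProbabilityMeasure X, ∀ g : C(X, ℝ),
      Tendsto (fun n => ∫ x, g x ∂(μ n : Measure X)) U (𝓝 (∫ x, g x ∂(μ₀ : Measure X))) := by
  obtain ⟨μ₀, hμ₀⟩ := exists_clusterPt_of_compactSpace (U.map μ : Filter (ProbabilityMeasure X))
  refine ⟨μ₀, fun g => ?_⟩
  have : Tendsto μ U (𝓝 μ₀) := (U.map μ).clusterPt_iff.1 hμ₀
  exact (ProbabilityMeasure.tendsto_iff_forall_integral_tendsto.1 this)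
    (BoundedContinuousFunction.mkOfCompact g)

/-- **Hausdorff moment problem**: a normalized completely monotone sequence is the moment sequence
of a probability measure on the unit interval. -/
theorem exists_probabilityMeasure_moments (m : ℕ → ℝ) (h0 : m 0 = 1)
    (hm : ∀ i j, 0 ≤ momentFunctional m (X ^ i * (1 - X) ^ j)) :
    ∃ μ : ProbabilityMeasure unitInterval, ∀ k, ∫ x, (x : ℝ) ^ k ∂(μ : Measure unitInterval) = m k := by
  -- These weights are nonnegative by `hm` and sum to `m 0 = 1`; placed at the points `i / N` they
  -- form a discrete approximation of the desired measure.
  set w : ℕ → ℕ → ℝ := fun N i => momentFunctional m (bernsteinPolynomial ℝ N i) with hw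
  have hw0 (N i) : 0 ≤ w N i := by
    simp only [hw, bernsteinPolynomial]
    rw [mul_assoc, ← map_natCast (C : ℝ →+* ℝ[X]), ← smul_eq_C_mul, map_smul, smul_eq_mul]
    exact mul_nonneg (by positivity) (hm _ _)
  have hw1 (N) : ∑ i ∈ Finset.range (N + 1), w N i = 1 := by
    rw [← map_sum, bernsteinPolynomial.sum, ← pow_zero X, momentFunctional_X_pow, h0]
  have hwk (N k) (hk : k ≤ N) (hN : 0 < N) :
      ∑ i ∈ Finset.range (N + 1), w N i * ((i.descFactorial k : ℝ) / N ^ k)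
        = (N.descFactorial k : ℝ) / N ^ k * m k := by
    have := congrArg (momentFunctional m) (sum_choose_smul_bernsteinPolynomial hk)
    simp only [map_sum, map_smul, smul_eq_mul, momentFunctional_X_pow] at this
    simp only [Nat.descFactorial_eq_factorial_mul_choose, Nat.cast_mul]
    rw [mul_div_right_comm, mul_assoc, ← this, Finset.mul_sum]
    exact Finset.sum_congr rfl fun i _ => by simp only [hw]; ring
  set p : ℕ → ℕ → unitInterval := fun N i => Set.projIcc 0 1 zero_le_one ((i : ℝ) / N)
  have hp (N i) (hi : i ∈ Finset.range (N + 1)) : (p N i : ℝ) = i / N := by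
    have : i ≤ N := Nat.lt_succ_iff.1 (Finset.mem_range.1 hi)
    refine congrArg Subtype.val (Set.projIcc_of_mem zero_le_one ⟨by positivity, ?_⟩)
    exact div_le_one_of_le₀ (by exact_mod_cast this) (by positivity)
  set μ : ℕ → Measure unitInterval := fun N =>
    ∑ i ∈ Finset.range (N + 1), ENNReal.ofReal (w N i) • Measure.dirac (p N i) with hμ
  have hprob (N) : IsProbabilityMeasure (μ N) := ⟨by
    simp only [hμ, Measure.coe_finsetSum, Finset.sum_apply, Measure.smul_apply, measure_univ,
      smul_eq_mul, mul_one]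
    rw [← ENNReal.ofReal_sum_of_nonneg fun i _ => hw0 N i, hw1, ENNReal.ofReal_one]⟩
  have hint (N k) : ∫ x, (x : ℝ) ^ k ∂(μ N)
      = ∑ i ∈ Finset.range (N + 1), w N i * ((i : ℝ) / N) ^ k := by
    simp only [hμ]
    rw [integral_finsetSum_measure fun i _ => ?_]
    · refine Finset.sum_congr rfl fun i hi => ?_
      rw [integral_smul_measure, integral_dirac, hp N i hi, ENNReal.toReal_ofReal (hw0 N i),
        smul_eq_mul]
    · exact (integrable_dirac (by finiteness)).smul_measure (by finiteness)
  -- There are two errors: `k² / N` from replacing powers by falling factorials, and `k² / N * |m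
  -- k|` from replacing the factor `N.descFactorial k / N ^ k` by `1`.
  have hlim (k) : Tendsto (fun N => ∫ x, (x : ℝ) ^ k ∂(μ N)) atTop (𝓝 (m k)) := by
    have hb : Tendsto (fun N : ℕ => (k : ℝ) ^ 2 / N * (1 + |m k|)) atTop (𝓝 0) := by
      simpa using (tendsto_const_div_atTop_nhds_zero_nat ((k : ℝ) ^ 2)).mul_const (1 + |m k|)
    refine tendsto_iff_dist_tendsto_zero.2 (squeeze_zero' (.of_forall fun _ => dist_nonneg) ?_ hb)
    filter_upwards [eventually_gt_atTop k] with N hN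
    have hN0 : 0 < N := by omega
    have hN' : (0 : ℝ) < N := by exact_mod_cast hN0
    have h1 : |∑ i ∈ Finset.range (N + 1), w N i * ((i : ℝ) / N) ^ k
        - (N.descFactorial k : ℝ) / N ^ k * m k| ≤ (k : ℝ) ^ 2 / N := by
      rw [← hwk N k hN.le hN0, ← Finset.sum_sub_distrib]
      refine (Finset.abs_sum_le_sum_abs _ _).trans ?_
      calc _ ≤ ∑ i ∈ Finset.range (N + 1), w N i * ((k : ℝ) ^ 2 / N) := by
            refine Finset.sum_le_sum fun i hi => ?_
            have := pow_div_sub_descFactorial_div_nonneg_and_le hN0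
              (Nat.lt_succ_iff.1 (Finset.mem_range.1 hi)) k
            rw [← mul_sub, abs_mul, abs_of_nonneg (hw0 N i), abs_of_nonneg (by linarith)]
            exact mul_le_mul_of_nonneg_left this.2.2 (hw0 N i)
        _ = _ := by rw [← Finset.sum_mul, hw1, one_mul]
    have h2 : |(N.descFactorial k : ℝ) / N ^ k * m k - m k| ≤ (k : ℝ) ^ 2 / N * |m k| := by
      have := pow_div_sub_descFactorial_div_nonneg_and_le hN0 le_rfl k
      rw [div_self hN'.ne', one_pow] at this
      rw [← sub_one_mul, abs_mul, abs_sub_comm, abs_of_nonneg (by linarith)]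
      exact mul_le_mul_of_nonneg_right this.2.2 (abs_nonneg _)
    rw [Real.dist_eq, hint, mul_add, mul_one]
    exact (abs_sub_le _ _ _).trans (add_le_add h1 h2)
  obtain ⟨μ₀, hμ₀⟩ := exists_probabilityMeasure_tendsto (hyperfilter ℕ)
    fun N => ⟨μ N, hprob N⟩
  refine ⟨μ₀, fun k => tendsto_nhds_unique (hμ₀ ⟨fun x => (x : ℝ) ^ k, by fun_prop⟩) ?_⟩
  exact (hlim k).mono_left Nat.hyperfilter_le_atTop

end HausdorffMoments

/-! ### From positive definiteness on the semigroup to a Laplace transform. -/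

section SemigroupSampling

open Polynomial Filter Topology

theorem momentFunctional_mul (m : ℕ → ℝ) (p q : ℝ[X]) :
    momentFunctional m (p * q)
      = ∑ i ∈ p.support, ∑ j ∈ q.support, p.coeff i * q.coeff j * m (i + j) := by
  conv_lhs => rw [p.as_sum_support, q.as_sum_support]
  simp only [Finset.sum_mul_sum, map_sum, monomial_mul_monomial, momentFunctional_monomial]

/-- Used with `r = 2` to compare sampling with step `h / 2` to sampling with step `h`. -/
theorem momentFunctional_expand (m : ℕ → ℝ) (r : ℕ) (p : ℝ[X]) :
    momentFunctional m (expand ℝ r p) = momentFunctional (fun k => m (k * r)) p := by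
  induction p using Polynomial.induction_on' with
  | add p q hp hq => simp only [map_add, hp, hq]
  | monomial n a => simp [expand_monomial, momentFunctional_monomial]

theorem abs_momentFunctional_le {m : ℕ → ℝ} {C : ℝ} (hm : ∀ k, |m k| ≤ C) (n : ℕ) (p : ℝ[X]) :
    |momentFunctional m (X ^ n * p)| ≤ ∑ i ∈ p.support, |p.coeff i| * C := by
  conv_lhs => rw [p.as_sum_support, Finset.mul_sum]
  simp only [map_sum, X_pow_mul_monomial, momentFunctional_monomial]
  refine (Finset.abs_sum_le_sum_abs _ _).trans (Finset.sum_le_sum fun i _ => ?_)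
  rw [abs_mul]
  exact mul_le_mul_of_nonneg_left (hm _) (abs_nonneg _)

/-- A bounded convex sequence is nonincreasing. -/
theorem le_of_convex_of_bounded {a : ℕ → ℝ} {C : ℝ} (hC : ∀ n, |a n| ≤ C)
    (hconv : ∀ n, 2 * a (n + 1) ≤ a n + a (n + 2)) : a 1 ≤ a 0 := by
  by_contra! h
  -- By convexity the increments never fall below the first one; if that is positive, `a` grows at
  -- least linearly and is unbounded.
  have hd (n : ℕ) : a 1 - a 0 ≤ a (n + 1) - a n := by
    induction n with
    | zero => simp
    | succ n ih => have := hconv n; rw [show n + 1 + 1 = n + 2 by ring]; linarith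
  have hl (n : ℕ) : a 0 + n * (a 1 - a 0) ≤ a n := by
    induction n with
    | zero => simp
    | succ n ih => have := hd n; push_cast; linarith
  obtain ⟨n, hn⟩ := exists_nat_gt ((C - a 0) / (a 1 - a 0))
  rw [div_lt_iff₀ (by linarith)] at hn
  linarith [hl n, le_abs_self (a n), hC n]

/-- A factor `1 - X` acts as a difference operator: `hp` says that `n ↦ L (X ^ n * p)` is convex.
This sequence is bounded, hence nonincreasing, so one factor `1 - X` can be dropped. -/
theorem momentFunctional_one_sub_X_mul_nonneg {m : ℕ → ℝ} {C : ℝ} (hm : ∀ k, |m k| ≤ C) (p : ℝ[X])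
    (hp : ∀ n, 0 ≤ momentFunctional m (X ^ n * ((1 - X) ^ 2 * p))) :
    0 ≤ momentFunctional m ((1 - X) * p) := by
  have := le_of_convex_of_bounded (a := fun n => momentFunctional m (X ^ n * p))
    (fun n => abs_momentFunctional_le hm n p) fun n => by
      have h := hp n
      rw [show (X : ℝ[X]) ^ n * ((1 - X) ^ 2 * p)
        = X ^ n * p - (X ^ (n + 1) * p + X ^ (n + 1) * p) + X ^ (n + 2) * p by ring] at h
      simp only [map_add, map_sub] at h
      linarith
  rw [sub_mul, map_sub, one_mul]
  simpa using this

/-- The kernel `f (s + t)` is positive semidefinite on `[0, ∞)`. -/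
def IsPosDefOnSemigroup (f : ℝ → ℝ) : Prop :=
  ∀ (t : Finset ℕ) (s c : ℕ → ℝ), (∀ i, 0 ≤ s i) →
    0 ≤ ∑ i ∈ t, ∑ j ∈ t, c i * c j * f (s i + s j)

variable {f : ℝ → ℝ}

theorem IsPosDefOnSemigroup.momentFunctional_mul_self (hf : IsPosDefOnSemigroup f) {h : ℝ}
    (hh : 0 ≤ h) (q : ℝ[X]) : 0 ≤ momentFunctional (fun k => f (k * h)) (q * q) := by
  rw [momentFunctional_mul]
  simpa only [Nat.cast_add, add_mul] using
    hf q.support (fun i => i * h) q.coeff fun i => by positivity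

/-- Halving the step replaces `X` by `X ^ 2`, so that `X ^ n * q ^ 2` becomes the square of `X ^ n *
q(X ^ 2)`, for odd `n` as well. -/
theorem IsPosDefOnSemigroup.momentFunctional_X_pow_mul_self (hf : IsPosDefOnSemigroup f) {h : ℝ}
    (hh : 0 ≤ h) (n : ℕ) (q : ℝ[X]) :
    0 ≤ momentFunctional (fun k => f (k * h)) (X ^ n * (q * q)) := by
  have := hf.momentFunctional_mul_self (h := h / 2) (by positivity) (X ^ n * expand ℝ 2 q)
  · rw [show X ^ n * expand ℝ 2 q * (X ^ n * expand ℝ 2 q) = expand ℝ 2 (X ^ n * (q * q)) by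
      simp only [map_mul, map_pow, expand_X]; ring, momentFunctional_expand] at this
    convert this using 5
    push_cast; ring

/-- For even `j` the power of `1 - X` is a square. An odd `j` is reached by descending from the even
exponent `j + 1`, which uses boundedness. -/
theorem IsPosDefOnSemigroup.momentFunctional_nonneg (hf : IsPosDefOnSemigroup f) {C : ℝ}
    (hC : ∀ t, 0 ≤ t → |f t| ≤ C) {h : ℝ} (hh : 0 ≤ h) (i j : ℕ) :
    0 ≤ momentFunctional (fun k => f (k * h)) (X ^ i * (1 - X) ^ j) := by
  obtain ⟨l, rfl | rfl⟩ := j.even_or_odd'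
  · convert hf.momentFunctional_X_pow_mul_self hh i ((1 - X) ^ l) using 2
    ring
  · have := momentFunctional_one_sub_X_mul_nonneg (m := fun k => f (k * h)) (C := C)
      (fun k => hC _ (by positivity)) (X ^ i * (1 - X) ^ (2 * l)) fun n => by
        convert hf.momentFunctional_X_pow_mul_self hh (n + i) ((1 - X) ^ (l + 1)) using 2
        ring
    convert this using 2
    ring

theorem IsPosDefOnSemigroup.exists_probabilityMeasure_sample (hf : IsPosDefOnSemigroup f)
    (h0 : f 0 = 1) (hC : ∀ t, 0 ≤ t → |f t| ≤ 1) {h : ℝ} (hh : 0 ≤ h) :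
    ∃ μ : ProbabilityMeasure unitInterval,
      ∀ k : ℕ, ∫ x, (x : ℝ) ^ k ∂(μ : Measure unitInterval) = f (k * h) :=
  exists_probabilityMeasure_moments _ (by simp [h0]) fun i j => hf.momentFunctional_nonneg hC hh i j

/-- A bounded positive definite function on the semigroup `[0, ∞)` is given at the dyadic rationals
by the power moments of a probability measure on the unit interval. -/
theorem IsPosDefOnSemigroup.exists_probabilityMeasure_dyadic (hf : IsPosDefOnSemigroup f)
    (h0 : f 0 = 1) (hC : ∀ t, 0 ≤ t → |f t| ≤ 1) :
    ∃ μ : ProbabilityMeasure unitInterval, ∀ k n : ℕ,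
      ∫ x, (x : ℝ) ^ ((k : ℝ) / 2 ^ n) ∂(μ : Measure unitInterval) = f (k / 2 ^ n) := by
  choose μ hμ using fun n : ℕ => hf.exists_probabilityMeasure_sample h0 hC
    (h := (2 ^ n)⁻¹) (by positivity)
  have hcont (n : ℕ) : Continuous fun x : unitInterval => x ^ 2 ^ n := by fun_prop
  -- Under `x ↦ x ^ 2 ^ n` the `k`-th moment of `μ n` becomes the moment of order `k / 2 ^ n`, so
  -- measures for different steps become comparable.
  obtain ⟨μ₀, hμ₀⟩ := exists_probabilityMeasure_tendsto (hyperfilter ℕ)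
    fun n => (μ n).map (hcont n).measurable.aemeasurable
  refine ⟨μ₀, fun k n => ?_⟩
  have hg : Continuous fun x : unitInterval => (x : ℝ) ^ ((k : ℝ) / 2 ^ n) := by
    exact continuous_subtype_val.rpow_const fun x => Or.inr (by positivity)
  refine tendsto_nhds_unique (hμ₀ ⟨_, hg⟩) (tendsto_const_nhds.congr' ?_)
  refine Nat.hyperfilter_le_atTop ?_
  -- Every grid finer than `2⁻ⁿ` contains `k / 2 ^ n`, so the sequence of integrals is eventually
  -- constant.
  filter_upwards [eventually_ge_atTop n] with N hN
  obtain ⟨d, rfl⟩ := Nat.exists_eq_add_of_le hN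
  rw [ProbabilityMeasure.toMeasure_map, integral_map (hcont _).measurable.aemeasurable
    (by exact hg.aestronglyMeasurable)]
  have := hμ (n + d) (k * 2 ^ d)
  rw [show ((k * 2 ^ d : ℕ) : ℝ) * (2 ^ (n + d))⁻¹ = k / 2 ^ n by
    push_cast; field_simp; ring] at this
  rw [← this]
  refine integral_congr_ae (.of_forall fun x => ?_)
  have hx : ((x ^ 2 ^ (n + d) : unitInterval) : ℝ) = (x : ℝ) ^ 2 ^ (n + d) := rfl
  simp only [ContinuousMap.coe_mk, hx]
  rw [← Real.rpow_natCast, ← Real.rpow_natCast, ← Real.rpow_mul x.2.1]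
  congr 1
  push_cast; field_simp; ring

/-- A continuous function on `[0, ∞)` that is bounded by its value `1` at `0` and positive definite
on the semigroup is given by the power moments of a probability measure on the unit interval without
atom at `0`. -/
theorem IsPosDefOnSemigroup.exists_probabilityMeasure_rpow (hf : IsPosDefOnSemigroup f)
    (h0 : f 0 = 1) (hC : ∀ t, 0 ≤ t → |f t| ≤ 1) (hcont : Continuous f) :
    ∃ μ : ProbabilityMeasure unitInterval, (∀ᵐ x : unitInterval ∂(μ : Measure unitInterval), (0 : ℝ) < x) ∧
      ∀ t, 0 ≤ t → ∫ x, (x : ℝ) ^ t ∂(μ : Measure unitInterval) = f t := by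
  obtain ⟨μ, hμ⟩ := hf.exists_probabilityMeasure_dyadic h0 hC
  have hbd (t : ℝ) (ht : 0 ≤ t) (x : unitInterval) : ‖(x : ℝ) ^ t‖ ≤ 1 := by
    rw [Real.norm_of_nonneg (Real.rpow_nonneg x.2.1 t)]
    exact Real.rpow_le_one x.2.1 x.2.2 ht
  -- As `t` decreases to `0`, `x ^ t` tends to the indicator of `x ≠ 0`; continuity of `f` at `0`
  -- then gives this set full mass.
  have hae : ∀ᵐ x : unitInterval ∂(μ : Measure unitInterval), (0 : ℝ) < x := by
    have hlim : Tendsto (fun n : ℕ => ((1 : ℕ) : ℝ) / 2 ^ n) atTop (𝓝 0) := by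
      simpa [Function.comp_def] using (tendsto_inv_atTop_zero (𝕜 := ℝ)).comp
        (tendsto_pow_atTop_atTop_of_one_lt one_lt_two)
    have h1 : Tendsto (fun n : ℕ => ∫ x, (x : ℝ) ^ (((1 : ℕ) : ℝ) / 2 ^ n)
        ∂(μ : Measure unitInterval)) atTop
        (𝓝 (∫ x, ({0}ᶜ : Set unitInterval).indicator (fun _ => (1 : ℝ)) x
          ∂(μ : Measure unitInterval))) := by
      refine tendsto_integral_of_dominated_convergence (fun _ => 1) (fun n => ?_)
        (integrable_const _) (fun n => .of_forall (hbd _ (by positivity))) (.of_forall fun x => ?_)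
      · exact (continuous_subtype_val.rpow_const
          fun x => Or.inr (by positivity)).aestronglyMeasurable
      by_cases hx : x = 0
      · subst hx
        simp
      · have hx' : (x : ℝ) ≠ 0 := fun h => hx (Subtype.ext h)
        have := (Real.continuous_const_rpow hx').tendsto 0 |>.comp hlim
        simpa [hx, Function.comp_def] using this
    have h2 : Tendsto (fun n : ℕ => ∫ x, (x : ℝ) ^ (((1 : ℕ) : ℝ) / 2 ^ n)
        ∂(μ : Measure unitInterval)) atTop (𝓝 1) := by
      simp only [hμ]
      simpa only [h0, Function.comp_def] using (hcont.tendsto 0).comp hlim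
    have h3 := tendsto_nhds_unique h1 h2
    rw [integral_indicator_const _ (measurableSet_singleton _).compl,
      probReal_compl_eq_one_sub (measurableSet_singleton _), smul_eq_mul, mul_one] at h3
    have h4 : (μ : Measure unitInterval) {0} = 0 := by
      rw [← measureReal_eq_zero_iff]; linarith
    filter_upwards [compl_mem_ae_iff.2 h4] with x hx
    exact lt_of_le_of_ne x.2.1 fun h => hx (Subtype.ext h.symm)
  refine ⟨μ, hae, fun t ht => ?_⟩
  have hlim : Tendsto (fun n : ℕ => (⌊t * 2 ^ n⌋₊ : ℝ) / 2 ^ n) atTop (𝓝 t) :=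
    (tendsto_nat_floor_mul_div_atTop ht).comp (tendsto_pow_atTop_atTop_of_one_lt one_lt_two)
  refine tendsto_nhds_unique (f := fun n : ℕ => ∫ x, (x : ℝ) ^ ((⌊t * 2 ^ n⌋₊ : ℝ) / 2 ^ n)
        ∂(μ : Measure unitInterval)) (l := atTop) ?_ ?_
  · refine tendsto_integral_of_dominated_convergence (fun _ => 1) (fun n => ?_)
        (integrable_const _) (fun n => .of_forall (hbd _ (by positivity))) ?_
    · exact (continuous_subtype_val.rpow_const
        fun x => Or.inr (by positivity)).aestronglyMeasurable
    · filter_upwards [hae] with x hx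
      exact ((Real.continuous_const_rpow hx.ne').tendsto t).comp hlim
  · simp only [hμ]
    exact (hcont.tendsto t).comp hlim

/-- A continuous positive definite function on the semigroup `[0, ∞)` that is bounded by its value
at `0` is the Laplace transform of a finite measure. -/
theorem IsPosDefOnSemigroup.exists_laplace (hf : IsPosDefOnSemigroup f)
    (hC : ∀ t, 0 ≤ t → |f t| ≤ f 0) (hcont : Continuous f) :
    ∃ ν : Measure ℝ≥0, IsFiniteMeasure ν ∧
      ∀ t, 0 ≤ t → ∫ l, Real.exp (-(l * t)) ∂ν = f t := by
  rcases eq_or_ne (f 0) 0 with h0 | h0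
  · refine ⟨0, inferInstance, fun t ht => ?_⟩
    have := hC t ht
    rw [h0] at this
    simp [abs_nonpos_iff.1 this]
  have h0' : 0 < f 0 := lt_of_le_of_ne ((abs_nonneg _).trans (hC 0 le_rfl)) h0.symm
  have hg : IsPosDefOnSemigroup fun t => (f 0)⁻¹ * f t := fun t s c hs => by
    have := mul_nonneg (inv_nonneg.2 h0'.le) (hf t s c hs)
    simp only [Finset.mul_sum] at this
    exact this.trans_eq
      (Finset.sum_congr rfl fun i _ => Finset.sum_congr rfl fun j _ => by ring)
  obtain ⟨μ, hae, hμ⟩ := hg.exists_probabilityMeasure_rpow (inv_mul_cancel₀ h0) (fun t ht => by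
    rw [abs_mul, abs_of_pos (inv_pos.2 h0'), inv_mul_le_iff₀ h0', mul_one]
    exact hC t ht) (by fun_prop)
  -- The substitution `l = -log x`; the default value at `x = 0` is harmless because this point is
  -- null by `hae`.
  have hm : Measurable fun x : unitInterval => (-Real.log x).toNNReal := by fun_prop
  refine ⟨ENNReal.ofReal (f 0) • (μ : Measure unitInterval).map
    (fun x : unitInterval => (-Real.log x).toNNReal),
    Measure.smul_finite _ ENNReal.ofReal_ne_top, fun t ht => ?_⟩
  rw [integral_smul_measure, integral_map hm.aemeasurable
    (by fun_prop), ENNReal.toReal_ofReal h0'.le, smul_eq_mul]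
  have h1 : ∫ x : unitInterval, Real.exp (-(((-Real.log x).toNNReal : ℝ) * t))
      ∂(μ : Measure unitInterval) = ∫ x, (x : ℝ) ^ t ∂(μ : Measure unitInterval) := by
    refine integral_congr_ae ?_
    filter_upwards [hae] with x hx
    rw [Real.coe_toNNReal _ (by linarith [Real.log_nonpos x.2.1 x.2.2]), Real.rpow_def_of_pos hx]
    congr 1
    ring
  rw [h1, hμ t ht, ← mul_assoc, mul_inv_cancel₀ h0, one_mul]

end SemigroupSampling

/-! ### Uniqueness of Laplace transforms and of their linear combinations. -/

section LaplaceUniqueness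

open Polynomial Filter Topology BoundedContinuousFunction

/-- The function `l ↦ e^{-l}` on `[0, ∞)`. -/
noncomputable def expNegBCF : ℝ≥0 →ᵇ ℝ :=
  BoundedContinuousFunction.ofNormedAddCommGroup (fun l : ℝ≥0 => Real.exp (-l)) (by fun_prop) 1
    fun l => by simp

/-- The algebra of polynomials in `l ↦ e^{-l}`. -/
noncomputable def expPolynomials : StarSubalgebra ℝ (ℝ≥0 →ᵇ ℝ) where
  toSubalgebra := (Polynomial.aeval (R := ℝ) expNegBCF).range
  star_mem' := fun {a} ha => by
    rwa [show star a = a from BoundedContinuousFunction.ext fun x => by simp]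

/-- A finite measure on `[0, ∞)` is determined by its Laplace transform. -/
theorem ext_of_laplace_eq {P P' : Measure ℝ≥0} [IsFiniteMeasure P] [IsFiniteMeasure P']
    (h : ∀ t : ℝ, 0 ≤ t → ∫ l, Real.exp (-(l * t)) ∂P = ∫ l, Real.exp (-(l * t)) ∂P') : P = P' := by
  -- Polynomials in `e^{-l}` separate points, and their integrals involve the Laplace transform at
  -- natural numbers only.
  refine ext_of_forall_mem_subalgebra_integral_eq_of_pseudoEMetric_complete_countable
    (A := expPolynomials) ?_ ?_
  · intro x y hxy
    refine ⟨expNegBCF, ⟨toContinuousMapStarₐ ℝ expNegBCF, ⟨expNegBCF, ⟨X, by simp⟩, rfl⟩, rfl⟩, ?_⟩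
    intro hE
    exact hxy (NNReal.coe_injective (neg_injective (Real.exp_injective hE)))
  · rintro g ⟨p, rfl⟩
    induction p using Polynomial.induction_on' with
    | add p q hp hq =>
      simp only [AlgHom.toRingHom_eq_coe, RingHom.coe_coe, map_add,
        BoundedContinuousFunction.coe_add, Pi.add_apply] at hp hq ⊢
      rw [integral_add (BoundedContinuousFunction.integrable _ _)
        (BoundedContinuousFunction.integrable _ _), integral_add
        (BoundedContinuousFunction.integrable _ _) (BoundedContinuousFunction.integrable _ _),
        hp, hq]
    | monomial n a =>
      have hx (l : ℝ≥0) : ((Polynomial.aeval (R := ℝ) expNegBCF) (monomial n a)) l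
          = a * Real.exp (-(l * n)) := by
        rw [aeval_monomial, Algebra.algebraMap_eq_smul_one, smul_mul_assoc, one_mul]
        simp only [BoundedContinuousFunction.coe_smul, BoundedContinuousFunction.coe_pow,
          Pi.pow_apply, smul_eq_mul]
        rw [show expNegBCF l = Real.exp (-l) from rfl, ← Real.exp_nat_mul]
        congr 2
        ring
      simp only [AlgHom.toRingHom_eq_coe, RingHom.coe_coe, hx]
      rw [integral_const_mul, integral_const_mul, h n (by positivity)]

theorem integrable_exp_neg_mul (P : Measure ℝ≥0) [IsFiniteMeasure P] {t : ℝ} (ht : 0 ≤ t) :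
    Integrable (fun l : ℝ≥0 => Real.exp (-(l * t))) P := by
  refine Integrable.of_bound (by fun_prop) 1 (.of_forall fun l => ?_)
  rw [Real.norm_of_nonneg (Real.exp_nonneg _), Real.exp_le_one_iff, neg_nonpos]
  positivity

/-- Moving the terms with negative coefficients to the other side leaves two positive finite
measures with equal Laplace transforms. -/
theorem sum_mul_measureReal_eq_zero_of_laplace_real {ι : Type*} (s : Finset ι) (a : ι → ℝ)
    (ν : ι → Measure ℝ≥0) [∀ i, IsFiniteMeasure (ν i)]
    (h : ∀ t : ℝ, 0 ≤ t → ∑ i ∈ s, a i * ∫ l, Real.exp (-(l * t)) ∂(ν i) = 0) (E : Set ℝ≥0) :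
    ∑ i ∈ s, a i * (ν i).real E = 0 := by
  have hfin (b : ι → ℝ) : IsFiniteMeasure (∑ i ∈ s, ENNReal.ofReal (b i) • ν i) := by
    refine ⟨?_⟩
    simp only [Measure.coe_finsetSum, Finset.sum_apply, Measure.smul_apply, smul_eq_mul]
    exact ENNReal.sum_lt_top.2 fun i _ => by finiteness
  have hreal (b : ι → ℝ) (hb : ∀ i, 0 ≤ b i) : (∑ i ∈ s, ENNReal.ofReal (b i) • ν i).real E
      = ∑ i ∈ s, b i * (ν i).real E := by
    simp only [Measure.real, Measure.coe_finsetSum, Finset.sum_apply, Measure.smul_apply,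
      smul_eq_mul]
    rw [ENNReal.toReal_sum fun i _ => by finiteness]
    simp only [ENNReal.toReal_mul, ENNReal.toReal_ofReal (hb _)]
  have hint (b : ι → ℝ) (hb : ∀ i, 0 ≤ b i) (t : ℝ) (ht : 0 ≤ t) :
      ∫ l, Real.exp (-(l * t)) ∂(∑ i ∈ s, ENNReal.ofReal (b i) • ν i)
        = ∑ i ∈ s, b i * ∫ l, Real.exp (-(l * t)) ∂(ν i) := by
    rw [integral_finsetSum_measure fun i _ =>
      (integrable_exp_neg_mul (ν i) ht).smul_measure (by finiteness)]
    simp only [integral_smul_measure, ENNReal.toReal_ofReal (hb _), smul_eq_mul]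
  have := hfin fun i => max (a i) 0
  have := hfin fun i => max (-a i) 0
  have hd (i) : a i = max (a i) 0 - max (-a i) 0 := (max_zero_sub_eq_self _).symm
  have key := ext_of_laplace_eq (P := ∑ i ∈ s, ENNReal.ofReal (max (a i) 0) • ν i)
    (P' := ∑ i ∈ s, ENNReal.ofReal (max (-a i) 0) • ν i) fun t ht => by
      rw [hint _ (fun i => le_max_right _ _) t ht, hint _ (fun i => le_max_right _ _) t ht,
        ← sub_eq_zero, ← Finset.sum_sub_distrib]
      refine Eq.trans ?_ (h t ht)
      exact Finset.sum_congr rfl fun i _ => by rw [← sub_mul, ← hd]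
  have key' := congrArg (fun P : Measure ℝ≥0 => P.real E) key
  rw [hreal _ fun i => le_max_right _ _, hreal _ fun i => le_max_right _ _, ← sub_eq_zero,
    ← Finset.sum_sub_distrib] at key'
  refine Eq.trans ?_ key'
  exact Finset.sum_congr rfl fun i _ => by rw [← sub_mul, ← hd]

/-- If a linear combination of Laplace transforms of finite measures vanishes, then so does the
linear combination of the measures. -/
theorem sum_mul_measureReal_eq_zero_of_laplace {𝕜 ι : Type*} [RCLike 𝕜] (s : Finset ι) (c : ι → 𝕜)
    (ν : ι → Measure ℝ≥0) [∀ i, IsFiniteMeasure (ν i)]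
    (h : ∀ t : ℝ, 0 ≤ t →
      ∑ i ∈ s, c i * ((∫ l, Real.exp (-(l * t)) ∂(ν i) : ℝ) : 𝕜) = 0) (E : Set ℝ≥0) :
    ∑ i ∈ s, c i * ((ν i).real E : 𝕜) = 0 := by
  refine RCLike.ext ?_ ?_
  · simp only [map_sum, RCLike.re_mul_ofReal, map_zero]
    refine sum_mul_measureReal_eq_zero_of_laplace_real s _ ν (fun t ht => ?_) E
    simpa only [map_sum, RCLike.re_mul_ofReal, map_zero] using congrArg RCLike.re (h t ht)
  · simp only [map_sum, RCLike.im_mul_ofReal, map_zero]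
    refine sum_mul_measureReal_eq_zero_of_laplace_real s _ ν (fun t ht => ?_) E
    simpa only [map_sum, RCLike.im_mul_ofReal, map_zero] using congrArg RCLike.im (h t ht)

end LaplaceUniqueness

/-! ### Integrals against vector measures as limits of Riemann sums. -/

section SimpleApproximation

open Filter Topology

/-- Simple functions on `[0, ∞)` that converge to the identity. -/
noncomputable def nnrealApprox (n : ℕ) : SimpleFunc ℝ≥0 ℝ≥0 :=
  (stronglyMeasurable_id (α := ℝ≥0)).approx n

theorem tendsto_nnrealApprox (x : ℝ≥0) : Tendsto (fun n => nnrealApprox n x) atTop (𝓝 x) :=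
  (stronglyMeasurable_id (α := ℝ≥0)).tendsto_approx x

/-- The integral of a bounded continuous function with respect to a vector measure of finite
variation is a limit of Riemann sums. -/
theorem tendsto_sum_smul_vectorMeasure {G : Type*} [NormedAddCommGroup G] [NormedSpace ℝ G]
    [CompleteSpace G] (μ : VectorMeasure ℝ≥0 G) [IsFiniteMeasure μ.variation] {g : ℝ≥0 → ℝ}
    (hg : Continuous g) {C : ℝ} (hC : ∀ l, |g l| ≤ C) :
    Tendsto (fun n => ∑ y ∈ (nnrealApprox n).range, g y • μ (nnrealApprox n ⁻¹' {y})) atTop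
      (𝓝 (μ.integral g (ContinuousLinearMap.lsmul ℝ ℝ))) := by
  have hsum (n : ℕ) : ∑ y ∈ (nnrealApprox n).range, g y • μ (nnrealApprox n ⁻¹' {y})
      = μ.integral (fun l => g (nnrealApprox n l)) (ContinuousLinearMap.lsmul ℝ ℝ) := by
    have hfun : (fun l => g (nnrealApprox n l)) = fun l => ∑ y ∈ (nnrealApprox n).range,
        (nnrealApprox n ⁻¹' {y}).indicator (fun _ => g y) l := by
      ext l
      rw [Finset.sum_eq_single (nnrealApprox n l)]
      · simp
      · intro y _ hy
        exact Set.indicator_of_notMem (fun h => hy h.symm) _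
      · intro h
        exact absurd (SimpleFunc.mem_range_self _ l) h
    rw [hfun, VectorMeasure.integral_finsetSum]
    · refine Finset.sum_congr rfl fun y _ => ?_
      rw [VectorMeasure.integral_indicator_const _ (SimpleFunc.measurableSet_fiber _ _)]
      rfl
    · intro y _
      exact (integrable_const _).indicator (SimpleFunc.measurableSet_fiber _ _)
  simp only [hsum]
  refine VectorMeasure.tendsto_integral_filter_of_norm_le_const (.of_forall fun n => ?_)
    ⟨C, .of_forall fun n => .of_forall fun l => hC _⟩
    (.of_forall fun l => (hg.tendsto l).comp (tendsto_nnrealApprox l))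
  exact (hg.measurable.comp (nnrealApprox n).measurable).aestronglyMeasurable

theorem tendsto_sum_mul_measureReal (ν : Measure ℝ≥0) [IsFiniteMeasure ν] {g : ℝ≥0 → ℝ}
    (hg : Continuous g) {C : ℝ} (hC : ∀ l, |g l| ≤ C) :
    Tendsto (fun n => ∑ y ∈ (nnrealApprox n).range, g y * ν.real (nnrealApprox n ⁻¹' {y})) atTop
      (𝓝 (∫ l, g l ∂ν)) := by
  have : IsFiniteMeasure ν.toSignedMeasure.variation := by
    rw [Measure.variation_toSignedMeasure]; infer_instance
  have h := tendsto_sum_smul_vectorMeasure ν.toSignedMeasure hg hC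
  rw [← VectorMeasure.integral_toSignedMeasure]
  have hB : (ContinuousLinearMap.lsmul ℝ ℝ : ℝ →L[ℝ] ℝ →L[ℝ] ℝ).flip
      = ContinuousLinearMap.lsmul ℝ ℝ := by
    ext; simp
  rw [hB]
  refine h.congr fun n => Finset.sum_congr rfl fun y _ => ?_
  rw [Measure.toSignedMeasure_apply_measurable (SimpleFunc.measurableSet_fiber _ _), smul_eq_mul]

/-- Bounded continuous functions are integrable with respect to a vector measure that is a linear
combination of finite measures, and the integral is the linear combination of the integrals. -/
theorem integrable_and_integral_eq_sum {𝕜 ι : Type*} [RCLike 𝕜] (μ : VectorMeasure ℝ≥0 𝕜)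
    (s : Finset ι) (c : ι → 𝕜) (ν : ι → Measure ℝ≥0) [∀ i, IsFiniteMeasure (ν i)]
    (h : ∀ E, MeasurableSet E → μ E = ∑ i ∈ s, c i * ((ν i).real E : 𝕜)) {g : ℝ≥0 → ℝ}
    (hg : Continuous g) {C : ℝ} (hC : ∀ l, |g l| ≤ C) :
    μ.Integrable g ∧ μ.integral g (ContinuousLinearMap.lsmul ℝ ℝ)
      = ∑ i ∈ s, c i * ((∫ l, g l ∂(ν i) : ℝ) : 𝕜) := by
  -- This domination makes the variation finite, hence bounded continuous functions integrable.
  have hvar : μ.variation ≤ ∑ i ∈ s, ‖c i‖ₑ • ν i := by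
    refine VectorMeasure.variation_le_of_forall_enorm_le fun E hE => ?_
    rw [h E hE]
    refine (enorm_sum_le _ _).trans ?_
    simp only [Measure.coe_finsetSum, Finset.sum_apply, Measure.smul_apply, smul_eq_mul]
    refine Finset.sum_le_sum fun i _ => ?_
    rw [enorm_mul]
    gcongr
    rw [← ofReal_norm, RCLike.norm_ofReal, abs_of_nonneg measureReal_nonneg,
      ofReal_measureReal]
  have hfin : IsFiniteMeasure (∑ i ∈ s, ‖c i‖ₑ • ν i) := by
    refine ⟨?_⟩
    simp only [Measure.coe_finsetSum, Finset.sum_apply, Measure.smul_apply, smul_eq_mul]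
    exact ENNReal.sum_lt_top.2 fun i _ => by finiteness
  have hfin' : IsFiniteMeasure μ.variation := isFiniteMeasure_of_le _ hvar
  refine ⟨Integrable.of_bound hg.aestronglyMeasurable C (.of_forall hC), ?_⟩
  -- Both sides are limits of the same Riemann sums, which involve only the values of `μ` and `ν i`
  -- on measurable fibres.
  refine tendsto_nhds_unique (tendsto_sum_smul_vectorMeasure μ hg hC) ?_
  have ht : Tendsto (fun n => ∑ i ∈ s, c i *
      ((∑ y ∈ (nnrealApprox n).range, g y * (ν i).real (nnrealApprox n ⁻¹' {y}) : ℝ) : 𝕜)) atTop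
      (𝓝 (∑ i ∈ s, c i * ((∫ l, g l ∂(ν i) : ℝ) : 𝕜))) :=
    tendsto_finsetSum _ fun i _ => Tendsto.const_mul _
      ((RCLike.continuous_ofReal.tendsto _).comp (tendsto_sum_mul_measureReal (ν i) hg hC))
  refine ht.congr fun n => ?_
  simp only [RCLike.ofReal_sum, Finset.mul_sum]
  rw [Finset.sum_comm]
  refine Finset.sum_congr rfl fun y _ => ?_
  rw [h _ (SimpleFunc.measurableSet_fiber _ _), RCLike.real_smul_eq_coe_mul, Finset.mul_sum]
  refine Finset.sum_congr rfl fun i _ => ?_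
  rw [RCLike.ofReal_mul]
  ring

end SimpleApproximation

/-! ### Positive semidefinite kernels and their integrals. -/

section PosSemidef

open Filter Topology Matrix

variable {𝕜 F : Type*} [RCLike 𝕜] [NormedAddCommGroup F] [InnerProductSpace 𝕜 F]

/-- Positivity is tested on finitely supported vectors, so entrywise convergence suffices even for
infinite `ι`. -/
theorem posSemidef_of_tendsto {ι : Type*} {M : ℕ → Matrix ι ι 𝕜} {A : Matrix ι ι 𝕜}
    (hM : ∀ n, (M n).PosSemidef) (h : ∀ i j, Tendsto (fun n => M n i j) atTop (𝓝 (A i j))) :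
    A.PosSemidef := by
  refine ⟨?_, fun x => ?_⟩
  · ext i j
    rw [conjTranspose_apply]
    refine tendsto_nhds_unique ((continuous_star.tendsto _).comp (h j i)) ?_
    refine (h i j).congr fun n => ((hM n).1.apply i j).symm
  · refine ge_of_tendsto' (f := fun n => x.sum fun i xi => x.sum fun j xj => star xi * M n i j * xj)
      (x := atTop) ?_ fun n => (hM n).2 x
    simp only [Finsupp.sum]
    exact tendsto_finsetSum _ fun i _ => tendsto_finsetSum _ fun j _ =>
      ((h i j).const_mul _).mul_const _

/-- The quadratic form at `x` equals `⟪u, A u⟫` with `u = ∑ x i • v i`. The case of the identity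
covers Gram matrices. -/
theorem posSemidef_inner_of_isPositive {ι : Type*} (A : F →L[𝕜] F) (hA : A.IsPositive)
    (v : ι → F) : (Matrix.of fun i j => inner 𝕜 (v i) (A (v j))).PosSemidef := by
  refine ⟨?_, fun x => ?_⟩
  · ext i j
    simp only [conjTranspose_apply, of_apply, RCLike.star_def, inner_conj_symm]
    exact hA.1 (v i) (v j)
  · have : x.sum (fun i xi => x.sum fun j xj =>
        star xi * (Matrix.of fun i j => inner 𝕜 (v i) (A (v j))) i j * xj)
        = inner 𝕜 (x.sum fun i xi => xi • v i) (A (x.sum fun i xi => xi • v i)) := by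
      simp only [Finsupp.sum, map_sum, map_smul, sum_inner, inner_sum, inner_smul_left,
        inner_smul_right, of_apply, RCLike.star_def]
      simp only [Finset.mul_sum]
      rw [Finset.sum_comm]
      refine Finset.sum_congr rfl fun i _ => Finset.sum_congr rfl fun j _ => ?_
      ring
    rw [this]
    exact hA.inner_nonneg_right _

/-- The kernel is the Gram matrix in `L²(ℝ)` of the vectors `e x`, that is `e^{-lx}` times the
indicator of `(0, e^{2lx}]`: their inner products are `e^{-l(x+y)} min(e^{2lx}, e^{2ly}) =
e^{-l|x-y|}`. -/
theorem posSemidef_exp_neg_mul_abs_sub (l : ℝ≥0) :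
    (Matrix.of fun x y : ℝ => ((Real.exp (-(l * |x - y|)) : ℝ) : 𝕜)).PosSemidef := by
  set e : ℝ → Lp 𝕜 2 (volume : Measure ℝ) := fun x =>
    ((Real.exp (-(l * x)) : ℝ) : 𝕜) • indicatorConstLp 2
      (measurableSet_Ioc (a := (0 : ℝ)) (b := Real.exp (2 * (l * x)))) measure_Ioc_lt_top.ne (1 : 𝕜)
  convert posSemidef_inner_of_isPositive (𝕜 := 𝕜) (.id 𝕜 (Lp 𝕜 2 (volume : Measure ℝ)))
    ContinuousLinearMap.isPositive_id e using 1
  ext x y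
  simp only [e, of_apply, ContinuousLinearMap.coe_id', id, inner_smul_left, inner_smul_right,
    L2.inner_indicatorConstLp_one_indicatorConstLp_one, RCLike.conj_ofReal]
  rw [Set.Ioc_inter_Ioc, measureReal_def, Real.volume_Ioc, max_self, sub_zero,
    ENNReal.toReal_ofReal (by positivity)]
  norm_cast
  rcases le_total x y with hxy | hxy
  · have : (l : ℝ) * x ≤ l * y := by gcongr
    rw [min_eq_left (Real.exp_le_exp.2 (by linarith)), ← Real.exp_add, ← Real.exp_add,
      abs_of_nonpos (by linarith)]
    congr 1; ring
  · have : (l : ℝ) * y ≤ l * x := by gcongr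
    rw [min_eq_right (Real.exp_le_exp.2 (by linarith)), ← Real.exp_add, ← Real.exp_add,
      abs_of_nonneg (by linarith)]
    congr 1; ring

theorem posSemidef_exp_neg_mul_add (l : ℝ≥0) :
    (Matrix.of fun x y : ℝ => ((Real.exp (-(l * (x + y))) : ℝ) : 𝕜)).PosSemidef := by
  convert posSemidef_inner_of_isPositive (𝕜 := 𝕜) (.id 𝕜 𝕜)
    ContinuousLinearMap.isPositive_id (fun x : ℝ => ((Real.exp (-(l * x)) : ℝ) : 𝕜)) using 1
  ext x y
  simp only [of_apply, ContinuousLinearMap.coe_id', id, RCLike.inner_apply, RCLike.conj_ofReal]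
  rw [← RCLike.ofReal_mul, ← Real.exp_add]
  congr 2; ring

/-- The weak integral of a positive semidefinite kernel with respect to a positive operator valued
measure is a positive semidefinite operator valued kernel. -/
theorem posSemidef_of_hasOperatorIntegral [CompleteSpace F] {ι : Type*}
    (Q : VectorMeasure ℝ≥0 (F →WOT[𝕜] F)) (hQ : IsPositiveOperatorMeasure Q)
    (hfin : ∀ v w, IsFiniteMeasure (matrixCoeff Q v w).variation) (K : ι → ι → ℝ≥0 → ℝ)
    (hK : ∀ l, (Matrix.of fun i j => ((K i j l : ℝ) : 𝕜)).PosSemidef)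
    (hcont : ∀ i j, Continuous (K i j)) {C : ℝ} (hC : ∀ i j l, |K i j l| ≤ C)
    (A : ι → ι → F →L[𝕜] F) (hA : ∀ i j, HasOperatorIntegral Q (K i j) (A i j)) (v : ι → F) :
    (Matrix.of fun i j => inner 𝕜 (v i) (A i j (v j))).PosSemidef := by
  -- Each Riemann summand is the Schur product of the kernel at `y` with the kernel defined by the
  -- positive operator `Q` of the fibre over `y`.
  refine posSemidef_of_tendsto (M := fun n => ∑ y ∈ (nnrealApprox n).range,
    (Matrix.of fun i j => ((K i j y : ℝ) : 𝕜)) ⊙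
      (Matrix.of fun i j => inner 𝕜 (v i) ((Q (nnrealApprox n ⁻¹' {y})).toCLM (v j))))
    (fun n => Matrix.posSemidef_sum _ fun y _ => (hK y).hadamard
      (posSemidef_inner_of_isPositive _ (hQ _) v)) fun i j => ?_
  have := hfin (v i) (v j)
  have h := tendsto_sum_smul_vectorMeasure (matrixCoeff Q (v i) (v j)) (hcont i j) (hC i j)
  rw [← (hA i j (v i) (v j)).2] at h
  refine h.congr fun n => ?_
  simp only [Matrix.sum_apply, hadamard_apply, of_apply, RCLike.real_smul_eq_coe_mul]
  rfl

end PosSemidef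

/-! ### Construction of the operator valued measure by polarization. -/

section OperatorMeasureOfLaplace

open Filter Topology

variable {𝕜 F : Type*} [RCLike 𝕜] [NormedAddCommGroup F] [InnerProductSpace 𝕜 F]

/-- The formal linear combination of vectors that expresses a sesquilinear form through its
quadratic form. -/
noncomputable def polarization (𝕜 : Type*) {F : Type*} [RCLike 𝕜] [NormedAddCommGroup F]
    [InnerProductSpace 𝕜 F] (v w : F) : F →₀ 𝕜 :=
  .single (v + w) (1 / 4) - .single (v - w) (1 / 4)
    - .single (v + (RCLike.I : 𝕜) • w) (RCLike.I / 4)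
    + .single (v - (RCLike.I : 𝕜) • w) (RCLike.I / 4)

theorem linearCombination_polarization (f : F → 𝕜) (v w : F) :
    Finsupp.linearCombination 𝕜 f (polarization 𝕜 v w)
      = (f (v + w) - f (v - w) - RCLike.I * f (v + (RCLike.I : 𝕜) • w)
        + RCLike.I * f (v - (RCLike.I : 𝕜) • w)) / 4 := by
  simp only [polarization, map_add, map_sub, Finsupp.linearCombination_single, smul_eq_mul]
  ring

/-- The linear combinations of the values of the quadratic form of `A`. -/
noncomputable def quadComb (A : F →L[𝕜] F) : (F →₀ 𝕜) →ₗ[𝕜] 𝕜 :=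
  Finsupp.linearCombination 𝕜 fun u => inner 𝕜 u (A u)

/-- Symmetry of `A` lets one formula serve both fields: over the reals `RCLike.I = 0`, and only the
first two terms of the polarization contribute. -/
theorem quadComb_polarization {A : F →L[𝕜] F} (hA : (A : F →ₗ[𝕜] F).IsSymmetric) (v w : F) :
    quadComb A (polarization 𝕜 v w) = inner 𝕜 v (A w) := by
  rw [quadComb, linearCombination_polarization]
  have h := hA.inner_map_polarization v w
  simp only [ContinuousLinearMap.coe_coe] at h
  have hs (x y : F) : inner 𝕜 (A x) y = inner 𝕜 x (A y) := hA x y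
  simp only [hs] at h
  exact h.symm

/-- The linear combinations of the values on `E` of a family of measures. -/
noncomputable def measureComb (𝕜 : Type*) {F : Type*} [RCLike 𝕜] (ν : F → Measure ℝ≥0)
    (E : Set ℝ≥0) : (F →₀ 𝕜) →ₗ[𝕜] 𝕜 :=
  Finsupp.linearCombination 𝕜 fun u => (((ν u).real E : ℝ) : 𝕜)

theorem inner_sum_apply {ι : Type*} (s : Finset ι) (A : ι → F →WOT[𝕜] F) (v w : F) :
    inner 𝕜 v ((∑ i ∈ s, A i) w) = ∑ i ∈ s, inner 𝕜 v (A i w) := by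
  classical
  induction s using Finset.induction_on with
  | empty => simp
  | insert i s hi ih => rw [Finset.sum_insert hi, Finset.sum_insert hi,
      ContinuousLinearMapWOT.add_apply, inner_add_right, ih]

/-- The family of measures `ν` represents the quadratic forms of the symmetric operators `φ t`,
`t ≥ 0`, through their Laplace transforms. -/
structure IsLaplaceFamily (φ : ℝ → F →L[𝕜] F) (ν : F → Measure ℝ≥0) : Prop where
  finite : ∀ v, IsFiniteMeasure (ν v)
  symmetric : ∀ t, ((φ t : F →L[𝕜] F) : F →ₗ[𝕜] F).IsSymmetric
  laplace : ∀ v t, 0 ≤ t →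
    inner 𝕜 v (φ t v) = ((∫ l, Real.exp (-(l * t)) ∂(ν v) : ℝ) : 𝕜)

namespace IsLaplaceFamily

variable {φ : ℝ → F →L[𝕜] F} {ν : F → Measure ℝ≥0} (H : IsLaplaceFamily φ ν)
include H

/-- The transfer principle: a relation between quadratic forms is one between Laplace transforms,
and uniqueness passes it to the measures. Sesquilinearity and hermitian symmetry of the form of `Q
E` follow from the same properties of `⟪v, φ t w⟫`. -/
theorem measureComb_eq {c d : F →₀ 𝕜} (h : ∀ t, 0 ≤ t → quadComb (φ t) c = quadComb (φ t) d)
    (E : Set ℝ≥0) : measureComb 𝕜 ν E c = measureComb 𝕜 ν E d := by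
  have := H.finite
  rw [← sub_eq_zero, ← map_sub, measureComb, Finsupp.linearCombination_apply, Finsupp.sum]
  simp only [smul_eq_mul]
  refine sum_mul_measureReal_eq_zero_of_laplace _ _ ν (fun t ht => ?_) E
  have h' := sub_eq_zero.2 (h t ht)
  rw [← map_sub, quadComb, Finsupp.linearCombination_apply, Finsupp.sum] at h'
  simpa only [smul_eq_mul, H.laplace _ t ht] using h'

theorem quadComb_pol (t : ℝ) (v w : F) :
    quadComb (φ t) (polarization 𝕜 v w) = inner 𝕜 v (φ t w) :=
  quadComb_polarization (H.symmetric t) v w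

theorem measureComb_self (E : Set ℝ≥0) (v : F) :
    measureComb 𝕜 ν E (polarization 𝕜 v v) = (((ν v).real E : ℝ) : 𝕜) := by
  rw [H.measureComb_eq (d := .single v 1) fun t _ => by rw [H.quadComb_pol]; simp [quadComb]]
  simp [measureComb]

theorem measureComb_conj (E : Set ℝ≥0) (v w : F) :
    measureComb 𝕜 ν E (polarization 𝕜 v w)
      = starRingEnd 𝕜 (measureComb 𝕜 ν E (polarization 𝕜 w v)) := by
  have hconj (f : F → 𝕜) (hf : ∀ u, starRingEnd 𝕜 (f u) = f u) (c : F →₀ 𝕜) :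
      Finsupp.linearCombination 𝕜 f (c.mapRange (starRingEnd 𝕜) (map_zero _))
        = starRingEnd 𝕜 (Finsupp.linearCombination 𝕜 f c) := by
    induction c using Finsupp.induction_linear with
    | zero => simp
    | add c d hc hd => rw [Finsupp.mapRange_add (by simp), map_add, map_add, map_add, hc, hd]
    | single u a => simp [hf]
  rw [measureComb, ← hconj _ fun u => RCLike.conj_ofReal _]
  refine H.measureComb_eq (fun t ht => ?_) E
  rw [H.quadComb_pol, quadComb, hconj _ fun u => by rw [H.laplace u t ht, RCLike.conj_ofReal]]
  change _ = starRingEnd 𝕜 (quadComb (φ t) (polarization 𝕜 w v))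
  rw [H.quadComb_pol, inner_conj_symm]
  exact (H.symmetric t v w).symm

/-- The total mass of `ν v` is the Laplace transform at `t = 0`, namely `⟪v, φ 0 v⟫`. -/
theorem measureReal_le (E : Set ℝ≥0) (v : F) : (ν v).real E ≤ ‖φ 0‖ * ‖v‖ ^ 2 := by
  have := H.finite v
  have h := H.laplace v 0 le_rfl
  simp only [mul_zero, neg_zero, Real.exp_zero, integral_const, smul_eq_mul, mul_one] at h
  calc (ν v).real E ≤ (ν v).real Set.univ := measureReal_mono (Set.subset_univ _)
    _ = ‖inner 𝕜 v (φ 0 v)‖ := by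
      rw [h, RCLike.norm_ofReal, abs_of_nonneg measureReal_nonneg]
    _ ≤ ‖v‖ * (‖φ 0‖ * ‖v‖) := (norm_inner_le_norm _ _).trans (by gcongr; exact (φ 0).le_opNorm v)
    _ = _ := by ring

/-- The sesquilinear form `⟪v, Q(E) w⟫`. -/
noncomputable def form (E : Set ℝ≥0) : F →ₗ⋆[𝕜] F →ₗ[𝕜] 𝕜 :=
  LinearMap.mk₂'ₛₗ (starRingEnd 𝕜) (RingHom.id 𝕜)
    (fun v w => measureComb 𝕜 ν E (polarization 𝕜 v w))
    (fun v v' w => by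
      rw [← map_add]
      exact H.measureComb_eq (fun t _ => by rw [map_add]; simp only [H.quadComb_pol, inner_add_left]) E)
    (fun a v w => by
      rw [← map_smul]
      exact H.measureComb_eq (fun t _ => by
        rw [map_smul]; simp only [H.quadComb_pol, inner_smul_left, smul_eq_mul]) E)
    (fun v w w' => by
      rw [← map_add]
      exact H.measureComb_eq (fun t _ => by
        rw [map_add]; simp only [H.quadComb_pol, map_add, inner_add_right]) E)
    (fun a v w => by
      rw [← map_smul]
      exact H.measureComb_eq (fun t _ => by
        rw [map_smul]
        simp only [H.quadComb_pol, map_smul, inner_smul_right, smul_eq_mul, RingHom.id_apply]) E)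

theorem form_apply (E : Set ℝ≥0) (v w : F) :
    H.form E v w = measureComb 𝕜 ν E (polarization 𝕜 v w) := rfl

theorem norm_form_le (E : Set ℝ≥0) (v w : F) : ‖H.form E v w‖ ≤ 4 * ‖φ 0‖ * ‖v‖ * ‖w‖ := by
  have h1 (v w : F) : ‖H.form E v w‖ ≤ ‖φ 0‖ * (‖v‖ + ‖w‖) ^ 2 := by
    have hI : ‖(RCLike.I : 𝕜)‖ ≤ 1 := by
      rcases eq_or_ne (RCLike.I : 𝕜) 0 with h | h
      · simp [h]
      · exact (RCLike.norm_I_of_ne_zero h).le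
    have hn (u : F) (hu : ‖u‖ ≤ ‖v‖ + ‖w‖) :
        ‖(((ν u).real E : ℝ) : 𝕜)‖ ≤ ‖φ 0‖ * (‖v‖ + ‖w‖) ^ 2 := by
      rw [RCLike.norm_ofReal, abs_of_nonneg measureReal_nonneg]
      refine (H.measureReal_le E u).trans ?_
      gcongr
    have hn' (u : F) (hu : ‖u‖ ≤ ‖v‖ + ‖w‖) :
        ‖(RCLike.I : 𝕜) * (((ν u).real E : ℝ) : 𝕜)‖ ≤ ‖φ 0‖ * (‖v‖ + ‖w‖) ^ 2 := by
      rw [norm_mul]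
      exact (mul_le_of_le_one_left (norm_nonneg _) hI).trans (hn u hu)
    have hIw : ‖(RCLike.I : 𝕜) • w‖ ≤ ‖w‖ := by
      rw [norm_smul]; exact mul_le_of_le_one_left (norm_nonneg _) hI
    rw [form_apply, measureComb, linearCombination_polarization, norm_div, RCLike.norm_ofNat,
      div_le_iff₀ (by norm_num)]
    have e1 := hn _ (norm_add_le v w)
    have e2 := hn _ (norm_sub_le v w)
    have e3 := hn' _ ((norm_add_le v _).trans (add_le_add_right hIw _))
    have e4 := hn' _ ((norm_sub_le v _).trans (add_le_add_right hIw _))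
    refine (norm_add_le _ _).trans ((add_le_add_left ((norm_sub_le _ _).trans
      (add_le_add_left (norm_sub_le _ _) _)) _).trans ?_)
    linarith
  rcases eq_or_ne v 0 with rfl | hv
  · simp
  rcases eq_or_ne w 0 with rfl | hw
  · simp
  -- Rescaling to unit vectors turns the bound `(‖v‖ + ‖w‖) ^ 2` into the constant `(1 + 1) ^ 2 =
  -- 4`.
  have h2 := h1 (((‖v‖ : 𝕜)⁻¹) • v) (((‖w‖ : 𝕜)⁻¹) • w)
  rw [norm_smul_inv_norm hv, norm_smul_inv_norm hw, map_smul, map_smulₛₗ, LinearMap.smul_apply,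
    norm_smul, norm_smul, RCLike.norm_conj, norm_inv, norm_inv, RCLike.norm_ofReal,
    RCLike.norm_ofReal, abs_norm, abs_norm, ← mul_assoc, ← mul_inv,
    inv_mul_le_iff₀ (by positivity)] at h2
  linarith

theorem hasSum_measureComb (c : F →₀ 𝕜) (f : ℕ → Set ℝ≥0) (hf : ∀ i, MeasurableSet (f i))
    (hd : Pairwise (Function.onFun Disjoint f)) :
    HasSum (fun i => measureComb 𝕜 ν (f i) c) (measureComb 𝕜 ν (⋃ i, f i) c) := by
  simp only [measureComb, Finsupp.linearCombination_apply, Finsupp.sum, smul_eq_mul]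
  refine hasSum_sum fun u _ => HasSum.mul_left _ ((RCLike.hasSum_ofReal 𝕜).2 ?_)
  have := H.finite u
  have h := (ν u).toSignedMeasure.m_iUnion hf hd
  simpa only [Measure.toSignedMeasure_apply_measurable (hf _),
    Measure.toSignedMeasure_apply_measurable (MeasurableSet.iUnion hf)] using h

variable [CompleteSpace F]

/-- The operator `Q(E)`. -/
noncomputable def operator (E : Set ℝ≥0) : F →L[𝕜] F :=
  InnerProductSpace.continuousLinearMapOfBilin
    (LinearMap.mkContinuous₂ (H.form E) (4 * ‖φ 0‖) (H.norm_form_le E))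

theorem inner_operator (E : Set ℝ≥0) (v w : F) :
    inner 𝕜 v (H.operator E w) = measureComb 𝕜 ν E (polarization 𝕜 v w) := by
  rw [H.measureComb_conj, ← inner_conj_symm, operator,
    InnerProductSpace.continuousLinearMapOfBilin_apply]
  rfl

theorem isPositive_operator (E : Set ℝ≥0) : (H.operator E).IsPositive := by
  refine ⟨fun v w => ?_, fun v => ?_⟩
  · change inner 𝕜 (H.operator E v) w = inner 𝕜 v (H.operator E w)
    rw [← inner_conj_symm, H.inner_operator, H.inner_operator, ← H.measureComb_conj]
  · rw [ContinuousLinearMap.reApplyInnerSelf_apply, inner_re_symm, H.inner_operator,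
      H.measureComb_self, RCLike.ofReal_re]
    exact measureReal_nonneg

open Classical in
/-- The operator valued measure `Q`. -/
noncomputable def operatorMeasure : VectorMeasure ℝ≥0 (F →WOT[𝕜] F) where
  measureOf' E := if MeasurableSet E then .ofCLM (H.operator E) else 0
  empty' := by
    rw [if_pos MeasurableSet.empty]
    ext v w
    rw [ContinuousLinearMapWOT.ofCLM_apply, H.inner_operator]
    simp [measureComb, Finsupp.linearCombination_apply]
  not_measurable' E hE := if_neg hE
  m_iUnion' f hf hd := by
    simp only [if_pos (hf _), if_pos (MeasurableSet.iUnion hf)]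
    refine ContinuousLinearMapWOT.tendsto_iff_forall_inner_apply_tendsto.2 fun w v => ?_
    rw [ContinuousLinearMapWOT.ofCLM_apply, H.inner_operator]
    refine (H.hasSum_measureComb (polarization 𝕜 v w) f hf hd).congr fun s => ?_
    simp only [inner_sum_apply, ContinuousLinearMapWOT.ofCLM_apply, H.inner_operator]

theorem operatorMeasure_apply {E : Set ℝ≥0} (hE : MeasurableSet E) :
    H.operatorMeasure E = .ofCLM (H.operator E) := if_pos hE

theorem isPositiveOperatorMeasure : IsPositiveOperatorMeasure H.operatorMeasure := by
  intro E
  by_cases hE : MeasurableSet E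
  · rw [H.operatorMeasure_apply hE]
    exact H.isPositive_operator E
  · rw [VectorMeasure.not_measurable _ hE]
    exact ContinuousLinearMap.isPositive_zero

/-- The matrix coefficient of the measure and `⟪v, φ t w⟫` are the same polarization combination, of
the `ν u` and of their Laplace transforms respectively. -/
theorem hasOperatorIntegral {t : ℝ} (ht : 0 ≤ t) :
    HasOperatorIntegral H.operatorMeasure (fun l => Real.exp (-(l * t))) (φ t) := by
  intro v w
  have := H.finite
  have h := integrable_and_integral_eq_sum (matrixCoeff H.operatorMeasure v w)
    (polarization 𝕜 v w).support (polarization 𝕜 v w) ν (fun E hE => by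
      change inner 𝕜 v (H.operatorMeasure E w) = _
      rw [H.operatorMeasure_apply hE, ContinuousLinearMapWOT.ofCLM_apply, H.inner_operator,
        measureComb, Finsupp.linearCombination_apply]
      rfl) (g := fun l => Real.exp (-(l * t))) (by fun_prop) (C := 1) fun l => by
        rw [abs_of_nonneg (Real.exp_nonneg _), Real.exp_le_one_iff, neg_nonpos]
        positivity
  refine ⟨h.1, ?_⟩
  rw [h.2, ← H.quadComb_pol, quadComb, Finsupp.linearCombination_apply]
  simp only [Finsupp.sum, smul_eq_mul, H.laplace _ t ht]

end IsLaplaceFamily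

end OperatorMeasureOfLaplace

/-! ### Reflection positivity and both directions of the equivalence. -/

section ReflectionPositive

open Filter Topology Matrix

/-- Real coefficients see only the real parts of the entries; passing to a submatrix allows repeated
points `p i`. -/
theorem sum_sum_re_nonneg {𝕜 I : Type*} [RCLike 𝕜] {M : Matrix I I 𝕜} (hM : M.PosSemidef)
    (t : Finset ℕ) (p : ℕ → I) (c : ℕ → ℝ) :
    0 ≤ ∑ i ∈ t, ∑ j ∈ t, c i * c j * RCLike.re (M (p i) (p j)) := by
  have h := (hM.submatrix fun i : t => p i).dotProduct_mulVec_nonneg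
    fun i : t => ((c i : ℝ) : 𝕜)
  have h' := (RCLike.nonneg_iff.1 h).1
  simp only [dotProduct, mulVec, submatrix_apply, Pi.star_apply, RCLike.star_def,
    RCLike.conj_ofReal, map_sum, RCLike.re_ofReal_mul, RCLike.re_mul_ofReal, Finset.mul_sum] at h'
  refine h'.trans_eq ?_
  rw [← Finset.sum_coe_sort t]
  refine Finset.sum_congr rfl fun i _ => ?_
  rw [← Finset.sum_coe_sort t]
  exact Finset.sum_congr rfl fun j _ => by ring

/-- An even continuous function on `ℝ` that is positive definite on the group `ℝ` and on the
semigroup `S` is the Laplace transform of a finite measure on `[0, ∞)`. -/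
theorem exists_laplace_of_posDef {S : Set ℝ} (hS : Set.Ioi 0 ⊆ S) {f : ℝ → ℝ} (hf : Continuous f)
    (heven : ∀ x, f (-x) = f x)
    (hpos : ∀ (t : Finset ℕ) (s c : ℕ → ℝ), 0 ≤ ∑ i ∈ t, ∑ j ∈ t, c i * c j * f (s i - s j))
    (hposS : ∀ (t : Finset ℕ) (s c : ℕ → ℝ), (∀ i, s i ∈ S) →
      0 ≤ ∑ i ∈ t, ∑ j ∈ t, c i * c j * f (s i + s j)) :
    ∃ ν : Measure ℝ≥0, IsFiniteMeasure ν ∧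
      ∀ t, 0 ≤ t → ∫ l, Real.exp (-(l * t)) ∂ν = f t := by
  refine IsPosDefOnSemigroup.exists_laplace (fun t s c hs => ?_) (fun x _ => ?_) hf
  -- The set `S` may omit `0`: the points are shifted by `1 / (n + 1)` into `(0, ∞)`, and continuity
  -- gives the limit.
  · have hlim : Tendsto (fun n : ℕ => ∑ i ∈ t, ∑ j ∈ t,
        c i * c j * f ((s i + 1 / ((n : ℝ) + 1)) + (s j + 1 / ((n : ℝ) + 1)))) atTop
        (𝓝 (∑ i ∈ t, ∑ j ∈ t, c i * c j * f (s i + s j))) := by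
      refine tendsto_finsetSum _ fun i _ => tendsto_finsetSum _ fun j _ => Tendsto.const_mul _ ?_
      refine (hf.tendsto _).comp ?_
      simpa using (tendsto_one_div_add_atTop_nhds_zero_nat.const_add (s i)).add
        (tendsto_one_div_add_atTop_nhds_zero_nat.const_add (s j))
    refine ge_of_tendsto' hlim fun n => hposS t _ c fun i => hS ?_
    have := hs i
    exact Set.mem_Ioi.2 (by positivity)
  -- The points `0, x` with coefficients `(1, 1)` and `(1, -1)` give `2 f 0 ± 2 f x ≥ 0`.
  · have h1 := hpos (Finset.range 2) (fun i => if i = 0 then 0 else x) fun _ => 1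
    have h2 := hpos (Finset.range 2) (fun i => if i = 0 then 0 else x)
      fun i => if i = 0 then 1 else -1
    simp [Finset.sum_range_succ, heven] at h1 h2
    rw [abs_le]
    constructor <;> linarith

variable {𝕜 F : Type*} [RCLike 𝕜] [NormedAddCommGroup F] [InnerProductSpace 𝕜 F] {S : Set ℝ}

theorem IsReflectionPositive.isSymmetric {φ : ℝ → F →L[𝕜] F}
    (h : IsReflectionPositive S (fun x => -x) φ) (t : ℝ) :
    (φ t : F →ₗ[𝕜] F).IsSymmetric := by
  intro v w
  have h1 := h.posDef.1.apply (0, v) (t, w)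
  simp only [of_apply, RCLike.star_def, inner_conj_symm, sub_zero, zero_sub] at h1
  rw [h.invariant t] at h1
  exact h1

theorem IsReflectionPositive.exists_isLaplaceFamily (hS : Set.Ioi 0 ⊆ S) {φ : ℝ → F →L[𝕜] F}
    (hφ : ∀ v, Continuous fun x => φ x v) (h : IsReflectionPositive S (fun x => -x) φ) :
    ∃ ν, IsLaplaceFamily φ ν := by
  have key (v : F) := exists_laplace_of_posDef hS (f := fun x => RCLike.re (inner 𝕜 v (φ x v)))
    (RCLike.continuous_re.comp (continuous_const.inner (hφ v))) (fun x => by rw [h.invariant x])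
    (fun t s c => sum_sum_re_nonneg h.posDef t (fun i => (s i, v)) c)
    (fun t s c hs => by
      simpa only [of_apply, neg_neg] using sum_sum_re_nonneg h.posDef_on t (fun i => (⟨s i, hs i⟩, v)) c)
  choose ν hν hlap using key
  refine ⟨ν, hν, h.isSymmetric, fun v t ht => ?_⟩
  rw [hlap v t ht]
  have := h.isSymmetric t v v
  exact (RCLike.conj_eq_iff_re.1 (by rw [inner_conj_symm]; exact this)).symm

theorem isReflectionPositive_of_hasOperatorIntegral [CompleteSpace F] (hS : S ⊆ Set.Ici 0)
    {φ : ℝ → F →L[𝕜] F} (Q : VectorMeasure ℝ≥0 (F →WOT[𝕜] F)) (hQ : IsPositiveOperatorMeasure Q)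
    (h : ∀ x : ℝ, HasOperatorIntegral Q (fun l => Real.exp (-(l * |x|))) (φ x)) :
    IsReflectionPositive S (fun x => -x) φ := by
  -- At `x = 0` the integrand is the constant `1`, whose integrability means finite variation.
  have hfin (v w : F) : IsFiniteMeasure (matrixCoeff Q v w).variation := by
    have := (h 0 v w).1
    simpa [VectorMeasure.Integrable, integrable_const_iff] using this
  have hbd {r : ℝ} (hr : 0 ≤ r) (l : ℝ≥0) : |Real.exp (-(l * r))| ≤ 1 := by
    rw [abs_of_nonneg (Real.exp_nonneg _), Real.exp_le_one_iff, neg_nonpos]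
    positivity
  refine ⟨?_, fun x => ?_, ?_⟩
  · refine posSemidef_of_hasOperatorIntegral (ι := ℝ × F) Q hQ hfin
      (fun p q l => Real.exp (-(l * |p.1 - q.1|)))
      (fun l => ?_) (fun p q => by fun_prop)
      (fun p q l => hbd (abs_nonneg _) l) (fun p q => φ (p.1 - q.1)) (fun p q => h _) Prod.snd
    exact (posSemidef_exp_neg_mul_abs_sub (𝕜 := 𝕜) l).submatrix Prod.fst
  · refine ContinuousLinearMap.ext fun w => ext_inner_left 𝕜 fun v => ?_
    rw [(h (-x) v w).2, (h x v w).2, abs_neg]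
  · have hnn (p : S × F) : 0 ≤ (p.1 : ℝ) := hS p.1.2
    refine posSemidef_of_hasOperatorIntegral (ι := S × F) Q hQ hfin
      (fun p q l => Real.exp (-(l * (p.1 + q.1))))
      (fun l => (posSemidef_exp_neg_mul_add (𝕜 := 𝕜) l).submatrix fun p : S × F => (p.1 : ℝ))
      (fun p q => by fun_prop) (fun p q l => hbd (add_nonneg (hnn p) (hnn q)) l)
      (fun p q => φ (p.1 + - -q.1)) (fun p q => ?_) Prod.snd
    have := h (p.1 + q.1)
    rw [abs_of_nonneg (add_nonneg (hnn p) (hnn q))] at this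
    rwa [neg_neg]

theorem posSemidef_integral {ι : Type*} (ν : Measure ℝ≥0) [IsFiniteMeasure ν] (K : ι → ι → ℝ≥0 → ℝ)
    (hK : ∀ l, (Matrix.of fun i j => ((K i j l : ℝ) : ℂ)).PosSemidef)
    (hcont : ∀ i j, Continuous (K i j)) {C : ℝ} (hC : ∀ i j l, |K i j l| ≤ C) :
    (Matrix.of fun i j => ((∫ l, K i j l ∂ν : ℝ) : ℂ)).PosSemidef := by
  refine posSemidef_of_tendsto (M := fun n => ∑ y ∈ (nnrealApprox n).range,
    ((ν.real (nnrealApprox n ⁻¹' {y}) : ℝ) : ℂ) • (Matrix.of fun i j => ((K i j y : ℝ) : ℂ)))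
    (fun n => Matrix.posSemidef_sum _ fun y _ => (hK y).smul
      (by exact_mod_cast measureReal_nonneg)) fun i j => ?_
  refine ((Complex.continuous_ofReal.tendsto _).comp
    (tendsto_sum_mul_measureReal ν (hcont i j) (hC i j))).congr fun n => ?_
  simp only [Matrix.sum_apply, Matrix.smul_apply, of_apply, Function.comp_apply, Complex.ofReal_sum,
    Complex.ofReal_mul, smul_eq_mul]
  exact Finset.sum_congr rfl fun y _ => mul_comm _ _

theorem IsReflectionPositiveScalar.exists_measure (hS : Set.Ioi 0 ⊆ S) {φ : ℝ → ℂ}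
    (hφ : Continuous φ) (h : IsReflectionPositiveScalar S (fun x => -x) φ) :
    ∃ ν : Measure ℝ≥0, IsFiniteMeasure ν ∧
      ∀ x : ℝ, φ x = ((∫ l, Real.exp (-(l * |x|)) ∂ν : ℝ) : ℂ) := by
  obtain ⟨ν, hν, hlap⟩ := exists_laplace_of_posDef hS (f := fun x => (φ x).re)
    (Complex.continuous_re.comp hφ) (fun x => by rw [h.invariant x])
    (fun t s c => sum_sum_re_nonneg h.posDef t s c)
    (fun t s c hs => by
      simpa only [of_apply, neg_neg] using! sum_sum_re_nonneg h.posDef_on t (fun i => ⟨s i, hs i⟩) c)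
  refine ⟨ν, hν, fun x => ?_⟩
  have h1 : φ |x| = φ x := by
    rcases abs_choice x with hx | hx <;> rw [hx]
    exact h.invariant x
  -- A hermitian kernel gives `conj (φ x) = φ (-x)`; together with evenness this makes `φ`
  -- real-valued.
  have h2 : starRingEnd ℂ (φ x) = φ x := by
    have := h.posDef.1.apply 0 x
    simp only [of_apply, sub_zero, zero_sub] at this
    exact this.trans (h.invariant x)
  rw [hlap _ (abs_nonneg x), h1]
  exact (Complex.conj_eq_iff_re.1 h2).symm

theorem isReflectionPositiveScalar_of_integral (hS : S ⊆ Set.Ici 0) {φ : ℝ → ℂ} (ν : Measure ℝ≥0)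
    [IsFiniteMeasure ν] (h : ∀ x : ℝ, φ x = ((∫ l, Real.exp (-(l * |x|)) ∂ν : ℝ) : ℂ)) :
    IsReflectionPositiveScalar S (fun x => -x) φ := by
  have hbd {r : ℝ} (hr : 0 ≤ r) (l : ℝ≥0) : |Real.exp (-(l * r))| ≤ 1 := by
    rw [abs_of_nonneg (Real.exp_nonneg _), Real.exp_le_one_iff, neg_nonpos]
    positivity
  refine ⟨?_, fun x => ?_, ?_⟩
  · simp only [h]
    exact posSemidef_integral ν (fun x y l => Real.exp (-(l * |x - y|)))
      posSemidef_exp_neg_mul_abs_sub (fun x y => by fun_prop) fun x y l => hbd (abs_nonneg _) l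
  · rw [h, h, abs_neg]
  · have hnn (s : S) : 0 ≤ (s : ℝ) := hS s.2
    have := posSemidef_integral ν (fun (s t : S) l => Real.exp (-(l * ((s : ℝ) + t))))
      (fun l => (posSemidef_exp_neg_mul_add l).submatrix Subtype.val) (fun x y => by fun_prop)
      fun s t l => hbd (add_nonneg (hnn s) (hnn t)) l
    convert this using 5 with s t
    rw [h, neg_neg, abs_of_nonneg (add_nonneg (hnn s) (hnn t))]

end ReflectionPositive

theorem mainTheorem4 {𝕜 F : Type*} [RCLike 𝕜] [NormedAddCommGroup F] [InnerProductSpace 𝕜 F]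
    [CompleteSpace F] (S : Set ℝ) (hS : S = Set.Ioi 0 ∨ S = Set.Ici 0) :
    (∀ φ : ℝ → F →L[𝕜] F, (∀ v : F, Continuous fun x => φ x v) →
      (IsReflectionPositive S (fun x => -x) φ ↔
        ∃ Q : VectorMeasure ℝ≥0 (F →WOT[𝕜] F), IsPositiveOperatorMeasure Q ∧
          ∀ x : ℝ, HasOperatorIntegral Q (fun l => Real.exp (-(l * |x|))) (φ x))) ∧
    (∀ φ : ℝ → ℂ, Continuous φ →
      (IsReflectionPositiveScalar S (fun x => -x) φ ↔
        ∃ ν : Measure ℝ≥0, IsFiniteMeasure ν ∧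
          ∀ x : ℝ, φ x = ((∫ l, Real.exp (-(l * |x|)) ∂ν : ℝ) : ℂ))) := by
  have hS1 : Set.Ioi 0 ⊆ S := by
    rcases hS with rfl | rfl
    exacts [subset_rfl, Set.Ioi_subset_Ici_self]
  have hS2 : S ⊆ Set.Ici 0 := by
    rcases hS with rfl | rfl
    exacts [Set.Ioi_subset_Ici_self, subset_rfl]
  refine ⟨fun φ hφ => ⟨fun h => ?_, fun ⟨Q, hQ, hint⟩ =>
    isReflectionPositive_of_hasOperatorIntegral hS2 Q hQ hint⟩, fun φ hφ =>
    ⟨fun h => h.exists_measure hS1 hφ, fun ⟨ν, hν, hint⟩ =>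
      isReflectionPositiveScalar_of_integral hS2 ν hint⟩⟩
  obtain ⟨ν, H⟩ := h.exists_isLaplaceFamily hS1 hφ
  refine ⟨H.operatorMeasure, H.isPositiveOperatorMeasure, fun x => ?_⟩
  have hx : φ |x| = φ x := by
    rcases abs_choice x with hx | hx <;> rw [hx]
    exact h.invariant x
  rw [← hx]
  exact H.hasOperatorIntegral (abs_nonneg x)
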